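/- Let $d\ge 1$, $R>0$, and let $\mathcal K,\mathcal K^*\subseteq B(0,R)$ be compact subsets of $\mathbb R^d$, where $B(0,r)$ denotes the closed Euclidean ball of radius $r$ about $0$. Let $W\subseteq\mathbb R^d$ be a convex cone (containing $0$, not necessarily closed) with nonempty interior, and let $W^\circ=\{y\in\mathbb R^d: w^\top y\ge 0\ \ \forall w\in W\}$ be its dual cone. Let $\mathcal O:W\to\mathcal K$ be an improper linear optimization oracle, i.e. $v^\top\mathcal O(v)\le\min_{x^*\in\mathcal K^*}v^\top x^*$ for all $v\in W$. Write $\Delta^{k-1}=\{p\in\mathbb R^k: p_i\ge 0,\ \sum_i p_i=1\}$. For $x\in B(0,R)$ and $\varepsilon\in(0,2R]$, the separation-or-decomposition oracle $\mathcal{SOD}(x,\varepsilon,W)$ is the following algorithm. Put $k=\lceil 5d\log\frac{4R}{\varepsilon}\rceil$ and $W_1=W\cap B(0,1)$. For $i=1,\dots,k$: let $w_i=\frac{1}{\mathrm{Vol}(W_i)}\int_{W_i}w\,dw$ be the centroid of $W_i$ (with $w_i=0$ if $\mathrm{Vol}(W_i)=0$) and call the oracle to obtain $v_i=\mathcal O(w_i)$;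 if $w_i^\top x\le w_i^\top v_i-\varepsilon$, stop and return the hyperplane $\left(\frac{w_i}{\|w_i\|},\frac{w_i^\top v_i}{\|w_i\|}\right)$; otherwise put $W_{i+1}=W_i\cap\{w: w^\top(v_i-x)\ge\varepsilon\}$. If the loop ends without returning, choose any minimizer $(p,c)$ of $\left\|\sum_{i=1}^k p_iv_i+c-x\right\|$ over $p\in\Delta^{k-1}$, $c\in W^\circ$, and return $V=(v_1,\dots,v_k)$ and $p$. Theorem. For every $x\in B(0,R)$ and $\varepsilon\in(0,2R]$, the algorithm $\mathcal{SOD}(x,\varepsilon,W)$ makes at most $k=\lceil 5d\log\frac{4R}{\varepsilon}\rceil$ calls to $\mathcal O$, all at points of $W$; it always returns an output (in particular the final minimum is attained whenever that step is reached); and every output it can return is one of the following two: 1. a decomposition $V=(v_1,\dots,v_k)$, $p\in\Delta^{k-1}$, with $v_i\in\mathcal K$ for all $i$ and $\left\|\sum_{i=1}^k p_iv_i-x+c\right\|\le 3\varepsilon$ for some $c\in W^\circ$; 2. a separating hyperplane $(w,b)\in\mathbb R^d\times\mathbb R$ with $\|w\|=1$ and $w^\top x\le b-\varepsilon\le\min_{x^*\in\mathcal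 K^*}w^\top x^*-\varepsilon$. -/

import Mathlib

/-- An adaptive computation that can call an oracle on queries in `Q`, receives answers in `A`,
and ends with a value in `α`. The oracle is accessible only through `call`. -/
inductive OracleProg (Q A α : Type) : Type where
  | done (a : α) : OracleProg Q A α
  | call (q : Q) (next : A → OracleProg Q A α) : OracleProg Q A α

namespace OracleProg

variable {Q A α : Type}

/-- The value with which the computation ends when its calls are answered by `O`. -/
def result (O : Q → A) : OracleProg Q A α → α
  | done a => a
  | call q next => (next (O q)).result O

/-- The queries made, in order, when the calls are answered by `O`;
the number of oracle calls is the length of this list. -/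
def queries (O : Q → A) : OracleProg Q A α → List Q
  | done _ => []
  | call q next => q :: (next (O q)).queries O

end OracleProg

/-- `O` is an improper linear optimization oracle for `(K, Kstar)` on the cone `W`: for `v ∈ W`
it gives a point of `K` with `vᵀ O(v) ≤ min_{y ∈ Kstar} vᵀ y`. Nothing is known about `O` outside
`W`. -/
structure IsImproperOracle {d : ℕ} (K Kstar : Set (EuclideanSpace ℝ (Fin d)))
    (W : PointedCone ℝ (EuclideanSpace ℝ (Fin d)))
    (O : EuclideanSpace ℝ (Fin d) → EuclideanSpace ℝ (Fin d)) : Prop where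
  mem : ∀ v ∈ W, O v ∈ K
  le : ∀ v ∈ W, ∀ y ∈ Kstar, inner ℝ v (O v) ≤ inner ℝ v y

/-- The two kinds of output of the separation-or-decomposition oracle: a decomposition
`(V, p)` with `n` points, or a hyperplane `(w, b)`. -/
inductive SODOutput (d : ℕ) : Type where
  | decomposition (n : ℕ) (V : Fin n → EuclideanSpace ℝ (Fin d)) (p : Fin n → ℝ) : SODOutput d
  | hyperplane (w : EuclideanSpace ℝ (Fin d)) (b : ℝ) : SODOutput d

/-- The centroid `(∫_S w dw) / vol(S)`. If `S` is a null set (for instance empty), this is `0`. -/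
noncomputable def centroid {d : ℕ} (S : Set (EuclideanSpace ℝ (Fin d))) :
    EuclideanSpace ℝ (Fin d) :=
  (MeasureTheory.volume.real S)⁻¹ • ∫ w in S, w

/-- `p` is the weight part of a minimizer `(p, c)` of `‖∑ i, p i • V i + c - x‖` over the
probability simplex times the dual cone `W° = {y | ∀ w ∈ W, 0 ≤ wᵀ y}`. -/
def IsOptimalWeights {d n : ℕ} (W : PointedCone ℝ (EuclideanSpace ℝ (Fin d)))
    (x : EuclideanSpace ℝ (Fin d)) (V : Fin n → EuclideanSpace ℝ (Fin d)) (p : Fin n → ℝ) : Prop :=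
  p ∈ stdSimplex ℝ (Fin n) ∧
    ∃ c ∈ ProperCone.innerDual (W : Set (EuclideanSpace ℝ (Fin d))),
      ∀ p' ∈ stdSimplex ℝ (Fin n),
        ∀ c' ∈ ProperCone.innerDual (W : Set (EuclideanSpace ℝ (Fin d))),
          ‖(∑ i, p i • V i) + c - x‖ ≤ ‖(∑ i, p' i • V i) + c' - x‖

/-- The loop of the separation-or-decomposition oracle, with `m` iterations left, current search
region `S` and answers `V` obtained so far, followed by the final minimization. Since the final
minimization can have several solutions, the value is the set of all outputs that the algorithm
may return. -/
noncomputable def sodLoop {d : ℕ} (x : EuclideanSpace ℝ (Fin d)) (ε : ℝ)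
    (W : PointedCone ℝ (EuclideanSpace ℝ (Fin d))) :
    ℕ → Set (EuclideanSpace ℝ (Fin d)) → List (EuclideanSpace ℝ (Fin d)) →
      OracleProg (EuclideanSpace ℝ (Fin d)) (EuclideanSpace ℝ (Fin d)) (Set (SODOutput d))
  | 0, _, V =>
      .done {out | ∃ p : Fin V.length → ℝ,
        IsOptimalWeights W x V.get p ∧ out = .decomposition V.length V.get p}
  | m + 1, S, V =>
      .call (centroid S) fun v =>
        if inner ℝ (centroid S) x ≤ inner ℝ (centroid S) v - ε then
          .done {.hyperplane (‖centroid S‖⁻¹ • centroid S) (inner ℝ (centroid S) v / ‖centroid S‖)}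
        else
          sodLoop x ε W m (S ∩ {u | ε ≤ inner ℝ u (v - x)}) (V ++ [v])

/-- The iteration bound `⌈5 d log (4 R / ε)⌉`. -/
noncomputable def sodBound (d : ℕ) (R ε : ℝ) : ℕ :=
  ⌈5 * (d : ℝ) * Real.log (4 * R / ε)⌉₊

/-- The separation-or-decomposition oracle. -/
noncomputable def sod {d : ℕ} (R : ℝ) (x : EuclideanSpace ℝ (Fin d)) (ε : ℝ)
    (W : PointedCone ℝ (EuclideanSpace ℝ (Fin d))) :
    OracleProg (EuclideanSpace ℝ (Fin d)) (EuclideanSpace ℝ (Fin d)) (Set (SODOutput d)) :=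
  sodLoop x ε W (sodBound d R ε)
    ((W : Set (EuclideanSpace ℝ (Fin d))) ∩ Metric.closedBall 0 1) []

/-- The guarantee for an output with tolerance `ε`: a decomposition has exactly `k` points, all in
`K`, and its mean is within `3 ε` of `x` up to an element of `W°`; a hyperplane `(w, b)` is unit
and satisfies `wᵀ x ≤ b - ε ≤ min_{y ∈ Kstar} wᵀ y - ε`. -/
def SODOutput.IsCorrect {d : ℕ} (K Kstar : Set (EuclideanSpace ℝ (Fin d)))
    (W : PointedCone ℝ (EuclideanSpace ℝ (Fin d))) (x : EuclideanSpace ℝ (Fin d)) (ε : ℝ) (k : ℕ) :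
    SODOutput d → Prop
  | .decomposition n V p =>
      n = k ∧ (∀ i, V i ∈ K) ∧ p ∈ stdSimplex ℝ (Fin n) ∧
        ∃ c ∈ ProperCone.innerDual (W : Set (EuclideanSpace ℝ (Fin d))),
          ‖(∑ i, p i • V i) - x + c‖ ≤ 3 * ε
  | .hyperplane w b =>
      ‖w‖ = 1 ∧ inner ℝ w x ≤ b - ε ∧ ∀ y ∈ Kstar, b - ε ≤ inner ℝ w y - ε

/-! The search regions keep track of the cone vectors that could still separate `x` from all the
answers obtained so far. When the stopping test fails at a centroid, the new constraint defines a
halfspace avoiding that centroid, so by Grünbaum's inequality a fraction at most `1 - 1/e` of the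
volume survives.

After `k` rounds the volume is below `(ε / (4R)) ^ d` times the initial one (`pow_natCeil_lt`).
Suppose the best decomposition were still farther than `3ε` from `x`. The residual of the projection
of `x` onto conv(V) + W° lies in the bidual of `W`, that is, in its closure, and can be perturbed to
a unit vector of `W` with margin `3ε` against every answer (`exists_unit_mem_cone_of_lt_norm`).
Contracting the initial region towards that vector by the factor `ε / (4R)` keeps it inside the
final region (`le_volume_real_searchRegion`), which is a contradiction.

Grünbaum's inequality is derived from Prékopa–Leindler: the volume of a convex body below height `t`
is log-concave in `t`, and comparison with an exponential majorant gives the constant `1/e`. -/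

section

open MeasureTheory Set
open scoped ENNReal Pointwise

/-! ### Brunn–Minkowski and Prékopa–Leindler inequalities. -/

/-- The one-dimensional Brunn–Minkowski inequality. -/
theorem Real.volume_add_volume_le {A B C : Set ℝ} (hA : MeasurableSet A) (hB : MeasurableSet B)
    (hA' : A.Nonempty) (hB' : B.Nonempty) (h : ∀ x ∈ A, ∀ y ∈ B, x + y ∈ C) :
    volume A + volume B ≤ volume C := by
  have key : ∀ K L : Set ℝ, IsCompact K → IsCompact L → K.Nonempty → L.Nonempty →
      K ⊆ A → L ⊆ B → volume K + volume L ≤ volume C := by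
    intro K L hK hL hK' hL' hKA hLB
    obtain ⟨x, hx, hxmax⟩ := hK.exists_isGreatest hK'
    obtain ⟨y, hy, hymin⟩ := hL.exists_isLeast hL'
    -- With `x = max K` and `y = min L`, the translates `K + y` and `x + L` lie on opposite sides of
    -- `x + y`, and both are contained in `C`.
    have hd : AEDisjoint volume ((fun z => z + y) '' K) ((fun z => x + z) '' L) := by
      refine measure_mono_null (t := {x + y}) ?_ (by simp)
      rintro _ ⟨⟨u, hu, rfl⟩, ⟨v, hv, huv⟩⟩
      have h1 := hxmax hu
      have h2 := hymin hv
      simp only [mem_singleton_iff] at *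
      linarith
    have hLm : MeasurableSet ((fun z => x + z) '' L) :=
      (hL.image (by fun_prop)).measurableSet
    calc volume K + volume L
        = volume ((fun z => z + y) '' K) + volume ((fun z => x + z) '' L) := by
          simp
      _ = volume (((fun z => z + y) '' K) ∪ ((fun z => x + z) '' L)) :=
          (measure_union₀ hLm.nullMeasurableSet hd).symm
      _ ≤ volume C := by
          apply measure_mono
          rintro _ (⟨u, hu, rfl⟩ | ⟨v, hv, rfl⟩)
          · exact h _ (hKA hu) _ (hLB hy)
          · exact h _ (hKA hx) _ (hLB hv)
  obtain ⟨x, hx⟩ := hA'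
  obtain ⟨y, hy⟩ := hB'
  rw [hA.measure_eq_iSup_isCompact, hB.measure_eq_iSup_isCompact]
  simp only [iSup_and']
  refine ENNReal.biSup_add_biSup_le' (p := fun K => K ⊆ A ∧ IsCompact K)
    (q := fun L => L ⊆ B ∧ IsCompact L) ⟨∅, empty_subset _, isCompact_empty⟩
    ⟨∅, empty_subset _, isCompact_empty⟩ fun K hK L hL => ?_
  -- The approximating compact sets may be empty; adding one point to each makes `key` applicable.
  refine le_trans ?_ (key (insert x K) (insert y L) (hK.2.insert x) (hL.2.insert y)
    (insert_nonempty _ _) (insert_nonempty _ _) (insert_subset hx hK.1) (insert_subset hy hL.1))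
  gcongr <;> exact subset_insert _ _

/-- The Prékopa–Leindler inequality as a property of a measure on a vector space. -/
def IsPrekopaLeindler {E : Type*} [AddCommGroup E] [Module ℝ E] [MeasurableSpace E]
    (μ : Measure E) : Prop :=
  ∀ a b : ℝ, 0 < a → 0 < b → a + b = 1 → ∀ f g h : E → ℝ≥0∞,
    Measurable f → Measurable g → Measurable h →
    (∀ x y, f x ^ a * g y ^ b ≤ h (a • x + b • y)) →
    (∫⁻ x, f x ∂μ) ^ a * (∫⁻ x, g x ∂μ) ^ b ≤ ∫⁻ x, h x ∂μ

theorem IsPrekopaLeindler.of_measurePreserving {E F : Type*} [AddCommGroup E] [Module ℝ E]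
    [MeasurableSpace E] [AddCommGroup F] [Module ℝ F] [MeasurableSpace F]
    {μ : Measure E} {ν : Measure F} (hμ : IsPrekopaLeindler μ) (φ : E →ₗ[ℝ] F)
    (hφ : MeasurePreserving φ μ ν) : IsPrekopaLeindler ν := by
  intro a b ha hb hab f g h hf hg hh hfgh
  rw [← hφ.lintegral_comp hf, ← hφ.lintegral_comp hg, ← hφ.lintegral_comp hh]
  refine hμ a b ha hb hab _ _ _ (hf.comp hφ.measurable) (hg.comp hφ.measurable)
    (hh.comp hφ.measurable) fun x y => ?_
  simpa using hfgh (φ x) (φ y)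

/-- Tensorization: the inequality for `ν` on the fibres says exactly that the fibre integrals
satisfy the hypothesis of the inequality for `μ`. -/
theorem IsPrekopaLeindler.prod {E F : Type*} [AddCommGroup E] [Module ℝ E]
    [MeasurableSpace E] [AddCommGroup F] [Module ℝ F] [MeasurableSpace F]
    {μ : Measure E} {ν : Measure F} [SFinite ν] (hμ : IsPrekopaLeindler μ)
    (hν : IsPrekopaLeindler ν) : IsPrekopaLeindler (μ.prod ν) := by
  intro a b ha hb hab f g h hf hg hh hfgh
  rw [lintegral_prod _ hf.aemeasurable, lintegral_prod _ hg.aemeasurable,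
    lintegral_prod _ hh.aemeasurable]
  refine hμ a b ha hb hab _ _ _ hf.lintegral_prod_right' hg.lintegral_prod_right'
    hh.lintegral_prod_right' fun x y => ?_
  exact hν a b ha hb hab _ _ _ (hf.comp measurable_prodMk_left) (hg.comp measurable_prodMk_left)
    (hh.comp measurable_prodMk_left) fun u v => hfgh (x, u) (y, v)

theorem ENNReal.rpow_mul_rpow_le_add {a b : ℝ} (ha : 0 < a) (hb : 0 < b) (hab : a + b = 1)
    (x y : ℝ≥0∞) : x ^ a * y ^ b ≤ ENNReal.ofReal a * x + ENNReal.ofReal b * y := by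
  have hpq : (a⁻¹).HolderConjugate b⁻¹ :=
    Real.holderConjugate_iff.2 ⟨(one_lt_inv₀ ha).2 (by linarith), by simpa using hab⟩
  have := ENNReal.young_inequality (x ^ a) (y ^ b) hpq
  rw [← ENNReal.rpow_mul, ← ENNReal.rpow_mul, mul_inv_cancel₀ ha.ne', mul_inv_cancel₀ hb.ne',
    ENNReal.rpow_one, ENNReal.rpow_one, div_eq_mul_inv, div_eq_mul_inv,
    ← ENNReal.ofReal_inv_of_pos (by positivity), ← ENNReal.ofReal_inv_of_pos (by positivity),
    inv_inv, inv_inv, mul_comm x, mul_comm y] at this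
  exact this

/-- The layer cake formula for functions with values in `[0, 1]`. -/
theorem lintegral_eq_lintegral_Ioo_meas_lt {α : Type*} [MeasurableSpace α] (μ : Measure α)
    {f : α → ℝ≥0∞} (hf : Measurable f) (hf1 : ∀ x, f x ≤ 1) :
    ∫⁻ x, f x ∂μ = ∫⁻ t in Ioo (0 : ℝ) 1, μ {x | ENNReal.ofReal t < f x} := by
  have hfin : ∀ x, f x ≠ ∞ := fun x => ((hf1 x).trans_lt ENNReal.one_lt_top).ne
  have h1 := lintegral_eq_lintegral_meas_lt μ (f := fun x => (f x).toReal)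
    (Filter.Eventually.of_forall fun x => ENNReal.toReal_nonneg) hf.ennreal_toReal.aemeasurable
  simp only [ENNReal.ofReal_toReal (hfin _)] at h1
  rw [h1, ← lintegral_indicator measurableSet_Ioi, ← lintegral_indicator measurableSet_Ioo]
  refine lintegral_congr fun t => ?_
  by_cases h0 : 0 < t
  · have hs : {x | t < (f x).toReal} = {x | ENNReal.ofReal t < f x} := by
      ext x
      simp only [mem_ofPred_eq, ENNReal.ofReal_lt_iff_lt_toReal h0.le (hfin x)]
    rw [indicator_of_mem (show t ∈ Ioi (0 : ℝ) from h0), hs]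
    by_cases ht1 : t < 1
    · rw [indicator_of_mem (show t ∈ Ioo (0 : ℝ) 1 from ⟨h0, ht1⟩)]
    · rw [indicator_of_notMem (fun h => ht1 h.2)]
      convert measure_empty (μ := μ)
      ext x
      simp only [mem_ofPred_eq, mem_empty_iff_false, iff_false, not_lt]
      exact (hf1 x).trans (by simpa using not_lt.1 ht1)
  · rw [indicator_of_notMem (show t ∉ Ioi (0 : ℝ) from h0),
      indicator_of_notMem (fun h => h0 h.1)]

/-- Equal suprema make `{f > t}` and `{g > t}` nonempty for the same `t < 1`. Then `a{f > t} + b{g >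
t} ⊆ {h > t}`, and integrating one-dimensional Brunn–Minkowski over `t` gives the arithmetic-mean
bound, which dominates the geometric mean. -/
theorem prekopaLeindler_real_of_le_one {a b : ℝ} (ha : 0 < a) (hb : 0 < b) (hab : a + b = 1)
    {f g h : ℝ → ℝ≥0∞} (hf : Measurable f) (hg : Measurable g) (hh : Measurable h)
    (hfgh : ∀ x y, f x ^ a * g y ^ b ≤ h (a • x + b • y))
    (hf1 : ⨆ x, f x = 1) (hg1 : ⨆ x, g x = 1) :
    (∫⁻ x, f x) ^ a * (∫⁻ x, g x) ^ b ≤ ∫⁻ x, h x := by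
  have hf1' : ∀ x, f x ≤ 1 := fun x => hf1 ▸ le_iSup f x
  have hg1' : ∀ x, g x ≤ 1 := fun x => hg1 ▸ le_iSup g x
  have hh' : ∫⁻ x, min (h x) 1 ≤ ∫⁻ x, h x := lintegral_mono fun x => min_le_left _ _
  refine (ENNReal.rpow_mul_rpow_le_add ha hb hab _ _).trans (le_trans ?_ hh')
  rw [lintegral_eq_lintegral_Ioo_meas_lt _ hf hf1', lintegral_eq_lintegral_Ioo_meas_lt _ hg hg1',
    lintegral_eq_lintegral_Ioo_meas_lt _ (hh.min measurable_const) (fun x => min_le_right _ _),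
    ← lintegral_const_mul' _ _ ENNReal.ofReal_ne_top,
    ← lintegral_const_mul' _ _ ENNReal.ofReal_ne_top]
  refine (le_lintegral_add _ _).trans (setLIntegral_mono' measurableSet_Ioo fun t ht => ?_)
  have ht1 : ENNReal.ofReal t < 1 := by simpa using ht.2
  have hfn : {x | ENNReal.ofReal t < f x}.Nonempty := by
    rw [← hf1] at ht1
    exact lt_iSup_iff.1 ht1
  have hgn : {x | ENNReal.ofReal t < g x}.Nonempty := by
    rw [← hg1] at ht1
    exact lt_iSup_iff.1 ht1
  have e : ∀ {c : ℝ}, 0 < c → ∀ s : Set ℝ, ENNReal.ofReal c * volume s = volume (c • s) := by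
    intro c hc s
    rw [Measure.addHaar_smul]
    simp [abs_of_pos hc]
  rw [e ha, e hb]
  refine Real.volume_add_volume_le ((measurableSet_lt measurable_const hf).const_smul₀ a)
    ((measurableSet_lt measurable_const hg).const_smul₀ b) hfn.smul_set hgn.smul_set ?_
  rintro _ ⟨x, hx, rfl⟩ _ ⟨y, hy, rfl⟩
  refine lt_min (lt_of_lt_of_le ?_ (hfgh x y)) ht1
  calc ENNReal.ofReal t = ENNReal.ofReal t ^ a * ENNReal.ofReal t ^ b := by
        rw [← ENNReal.rpow_add_of_nonneg _ _ ha.le hb.le, hab, ENNReal.rpow_one]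
    _ < f x ^ a * g y ^ b :=
        ENNReal.mul_lt_mul (ENNReal.rpow_lt_rpow hx ha) (ENNReal.rpow_lt_rpow hy hb)

/-- Both sides are homogeneous, so `f` and `g` can be divided by their suprema and `h` by the
matching product of powers. -/
theorem prekopaLeindler_real_of_bounded {a b : ℝ} (ha : 0 < a) (hb : 0 < b) (hab : a + b = 1)
    {f g h : ℝ → ℝ≥0∞} (hf : Measurable f) (hg : Measurable g) (hh : Measurable h)
    (hfgh : ∀ x y, f x ^ a * g y ^ b ≤ h (a • x + b • y))
    (hM : ⨆ x, f x ≠ ∞) (hN : ⨆ x, g x ≠ ∞) :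
    (∫⁻ x, f x) ^ a * (∫⁻ x, g x) ^ b ≤ ∫⁻ x, h x := by
  set M := ⨆ x, f x with hMdef
  set N := ⨆ x, g x with hNdef
  rcases eq_or_ne M 0 with hM0 | hM0
  · have : ∀ x, f x = 0 := fun x => le_antisymm (hM0 ▸ le_iSup f x) zero_le
    simp [this, ENNReal.zero_rpow_of_pos ha]
  rcases eq_or_ne N 0 with hN0 | hN0
  · have : ∀ x, g x = 0 := fun x => le_antisymm (hN0 ▸ le_iSup g x) zero_le
    simp [this, ENNReal.zero_rpow_of_pos hb]
  have key := prekopaLeindler_real_of_le_one ha hb hab (hf.const_mul M⁻¹) (hg.const_mul N⁻¹)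
    (hh.const_mul ((M⁻¹) ^ a * (N⁻¹) ^ b)) (fun x y => ?_) ?_ ?_
  · rw [lintegral_const_mul _ hf, lintegral_const_mul _ hg, lintegral_const_mul _ hh,
      ENNReal.mul_rpow_of_nonneg _ _ ha.le, ENNReal.mul_rpow_of_nonneg _ _ hb.le,
      mul_mul_mul_comm] at key
    refine (ENNReal.mul_le_mul_iff_right ?_ ?_).1 key
    · simp [ha, hb, ha.not_gt, hb.not_gt, hM, hN]
    · apply ENNReal.mul_ne_top <;> apply ENNReal.rpow_ne_top_of_nonneg <;>
        simp [ha.le, hb.le, hM0, hN0]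
  · rw [ENNReal.mul_rpow_of_nonneg _ _ ha.le, ENNReal.mul_rpow_of_nonneg _ _ hb.le,
      mul_mul_mul_comm]
    gcongr
    exact hfgh x y
  · rw [← ENNReal.mul_iSup, ENNReal.inv_mul_cancel hM0 hM]
  · rw [← ENNReal.mul_iSup, ENNReal.inv_mul_cancel hN0 hN]

theorem tendsto_lintegral_min_natCast {α : Type*} [MeasurableSpace α] (μ : Measure α)
    {f : α → ℝ≥0∞} (hf : Measurable f) :
    Filter.Tendsto (fun n : ℕ => ∫⁻ x, min (f x) n ∂μ) Filter.atTop (nhds (∫⁻ x, f x ∂μ)) := by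
  refine lintegral_tendsto_of_tendsto_of_monotone
    (fun n => (hf.min measurable_const).aemeasurable)
    (Filter.Eventually.of_forall fun x m n hmn => ?_) (Filter.Eventually.of_forall fun x => ?_)
  · dsimp only
    gcongr
  · have := (tendsto_const_nhds (x := f x)).min ENNReal.tendsto_nat_nhds_top
    simpa using this

theorem isPrekopaLeindler_real : IsPrekopaLeindler (volume : Measure ℝ) := by
  intro a b ha hb hab f g h hf hg hh hfgh
  rcases eq_or_ne (∫⁻ x, f x) 0 with hf0 | hf0
  · simp [hf0, ENNReal.zero_rpow_of_pos ha]
  rcases eq_or_ne (∫⁻ x, g x) 0 with hg0 | hg0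
  · simp [hg0, ENNReal.zero_rpow_of_pos hb]
  -- The truncated integrals converge; excluding zero integrals avoids `0 * ∞`, where multiplication
  -- is discontinuous.
  have hlim := ENNReal.Tendsto.mul
    ((ENNReal.continuous_rpow_const (y := a)).continuousAt.tendsto.comp
      (tendsto_lintegral_min_natCast volume hf))
    (Or.inl (by simp [hf0, ha, ha.not_gt]))
    ((ENNReal.continuous_rpow_const (y := b)).continuousAt.tendsto.comp
      (tendsto_lintegral_min_natCast volume hg))
    (Or.inl (by simp [hg0, hb, hb.not_gt]))
  refine le_of_tendsto' hlim fun n => ?_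
  refine prekopaLeindler_real_of_bounded ha hb hab (hf.min measurable_const)
    (hg.min measurable_const) hh (fun x y => le_trans ?_ (hfgh x y)) ?_ ?_
  · gcongr <;> exact min_le_left _ _
  · exact ne_top_of_le_ne_top (ENNReal.natCast_ne_top n) (iSup_le fun x => min_le_right _ _)
  · exact ne_top_of_le_ne_top (ENNReal.natCast_ne_top n) (iSup_le fun x => min_le_right _ _)

theorem isPrekopaLeindler_pi (n : ℕ) : IsPrekopaLeindler (volume : Measure (Fin n → ℝ)) := by
  induction n with
  | zero =>
    intro a b ha hb hab f g h hf hg hh hfgh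
    have hv : (volume : Measure (Fin 0 → ℝ)) univ = 1 := by simp [volume_pi]
    simp only [lintegral_unique, hv, mul_one]
    convert hfgh default default
  | succ n ih =>
    have hp := (volume_preserving_piFinSuccAbove (fun _ : Fin (n + 1) => ℝ) 0).symm
    exact (isPrekopaLeindler_real.prod ih).of_measurePreserving
      { toFun := (MeasurableEquiv.piFinSuccAbove (fun _ : Fin (n + 1) => ℝ) 0).symm
        map_add' := fun x y => by
          ext i
          refine Fin.cases ?_ (fun j => ?_) i <;> simp [MeasurableEquiv.piFinSuccAbove]
        map_smul' := fun c x => by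
          ext i
          refine Fin.cases ?_ (fun j => ?_) i <;> simp [MeasurableEquiv.piFinSuccAbove] } hp

theorem isPrekopaLeindler_euclideanSpace (d : ℕ) :
    IsPrekopaLeindler (volume : Measure (EuclideanSpace ℝ (Fin d))) :=
  (isPrekopaLeindler_pi d).of_measurePreserving
    (WithLp.linearEquiv 2 ℝ (Fin d → ℝ)).symm.toLinearMap (PiLp.volume_preserving_toLp (Fin d))

/-- The multiplicative Brunn–Minkowski inequality. -/
theorem volume_rpow_mul_volume_rpow_le {d : ℕ} {a b : ℝ} (ha : 0 < a) (hb : 0 < b)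
    (hab : a + b = 1) {A B C : Set (EuclideanSpace ℝ (Fin d))} (hA : MeasurableSet A)
    (hB : MeasurableSet B) (hC : MeasurableSet C)
    (h : ∀ x ∈ A, ∀ y ∈ B, a • x + b • y ∈ C) :
    volume A ^ a * volume B ^ b ≤ volume C := by
  have := isPrekopaLeindler_euclideanSpace d a b ha hb hab (A.indicator 1) (B.indicator 1)
    (C.indicator 1) (measurable_one.indicator hA) (measurable_one.indicator hB)
    (measurable_one.indicator hC) fun x y => ?_
  · simpa [lintegral_indicator_one, hA, hB, hC] using this
  · by_cases hx : x ∈ A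
    · by_cases hy : y ∈ B
      · simp [hx, hy, h x hx y hy]
      · simp [hy, ENNReal.zero_rpow_of_pos hb]
    · simp [hx, ENNReal.zero_rpow_of_pos ha]

/-! ### Log-concavity of volume and Grünbaum's inequality. -/

/-- A monotone log-concave function has a log-affine majorant touching it at `t`. -/
theorem exists_le_mul_exp_of_logConcave {F : ℝ → ℝ} (hF0 : ∀ t, 0 ≤ F t) (hFm : Monotone F)
    (hF : ∀ a b : ℝ, 0 < a → 0 < b → a + b = 1 → ∀ s t,
      F s ^ a * F t ^ b ≤ F (a * s + b * t)) {s₀ t : ℝ} (hst : s₀ < t) (hs₀ : 0 < F s₀) :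
    ∃ α : ℝ, ∀ s, F s ≤ F t * Real.exp (α * (s - t)) := by
  set S : Set ℝ := {s | 0 < F s} with hS
  have hconc : ConcaveOn ℝ S (fun s => Real.log (F s)) := by
    refine concaveOn_iff_forall_pos.2 ⟨?_, ?_⟩
    · refine Set.OrdConnected.convex ⟨fun x hx y _ z hz => ?_⟩
      exact lt_of_lt_of_le (show 0 < F x from hx) (hFm hz.1)
    · intro x hx y hy a b ha hb hab
      have hx' : 0 < F x := hx
      have hy' : 0 < F y := hy
      simp only [smul_eq_mul]
      rw [← Real.log_rpow hx', ← Real.log_rpow hy', ← Real.log_mul (by positivity) (by positivity)]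
      exact Real.log_le_log (by positivity) (hF a b ha hb hab x y)
  have htS : t ∈ interior S :=
    mem_interior.2 ⟨Ioi s₀, fun s hs => lt_of_lt_of_le hs₀ (hFm (le_of_lt hs)), isOpen_Ioi, hst⟩
  have htS' : t ∈ S := interior_subset htS
  have ht0 : 0 < F t := htS'
  have hconv : ConvexOn ℝ S (-fun s => Real.log (F s)) := hconc.neg
  -- The slope `α` is the right derivative of `log F` at `t`: a supporting line of the concave
  -- function `log F`, exponentiated. Where `F` vanishes the bound is trivial.
  refine ⟨-derivWithin (-fun s => Real.log (F s)) (Ioi t) t, fun s => ?_⟩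
  rcases (hF0 s).eq_or_lt with h0 | h0
  · rw [← h0]
    positivity
  rw [← Real.log_le_log_iff h0 (by positivity), Real.log_mul ht0.ne' (Real.exp_ne_zero _),
    Real.log_exp]
  rcases lt_trichotomy s t with h | rfl | h
  · have h1 := (hconv.slope_le_leftDeriv_of_mem_interior h0 htS h).trans
      (hconv.leftDeriv_le_rightDeriv_of_mem_interior htS)
    rw [slope_def_field, div_le_iff₀ (by linarith)] at h1
    simp only [Pi.neg_apply] at h1
    linarith
  · simp
  · have h1 := hconv.rightDeriv_le_slope_of_mem_interior htS h0 h
    rw [slope_def_field, le_div_iff₀ (by linarith)] at h1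
    simp only [Pi.neg_apply] at h1
    linarith

section Grunbaum

variable {d : ℕ}

theorem measurableSet_inner_lt (a : EuclideanSpace ℝ (Fin d)) (t : ℝ) :
    MeasurableSet {u | inner ℝ u a < t} :=
  (isOpen_lt (by fun_prop) continuous_const).measurableSet

theorem integrableOn_of_isBounded {E : Type*} [NormedAddCommGroup E]
    {S : Set (EuclideanSpace ℝ (Fin d))} (hS : Bornology.IsBounded S)
    {f : EuclideanSpace ℝ (Fin d) → E} (hf : Continuous f) : IntegrableOn f S :=
  (hf.continuousOn.integrableOn_compact hS.isCompact_closure).mono_set subset_closure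

/-- The volume below height `t` is a log-concave function of `t`. -/
theorem volume_real_inner_lt_rpow_mul_le {K : Set (EuclideanSpace ℝ (Fin d))} (hKo : IsOpen K)
    (hKc : Convex ℝ K) (hKb : Bornology.IsBounded K) (v : EuclideanSpace ℝ (Fin d)) {a b : ℝ}
    (ha : 0 < a) (hb : 0 < b) (hab : a + b = 1) (s t : ℝ) :
    volume.real (K ∩ {u | inner ℝ u v < s}) ^ a * volume.real (K ∩ {u | inner ℝ u v < t}) ^ b ≤
      volume.real (K ∩ {u | inner ℝ u v < a * s + b * t}) := by
  have hm : ∀ t, MeasurableSet (K ∩ {u | inner ℝ u v < t}) := fun t =>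
    hKo.measurableSet.inter (measurableSet_inner_lt v t)
  have hfin : volume (K ∩ {u | inner ℝ u v < a * s + b * t}) ≠ ∞ :=
    ((hKb.subset inter_subset_left).measure_lt_top).ne
  have := ENNReal.toReal_mono hfin (volume_rpow_mul_volume_rpow_le ha hb hab (hm s) (hm t)
    (hm (a * s + b * t)) ?_)
  · simpa [ENNReal.toReal_mul, ENNReal.toReal_rpow, Measure.real] using this
  · rintro x ⟨hx, hxs⟩ y ⟨hy, hyt⟩
    refine ⟨hKc hx hy ha.le hb.le hab, ?_⟩
    have hxs' : inner ℝ x v < s := hxs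
    have hyt' : inner ℝ y v < t := hyt
    show inner ℝ (a • x + b • y) v < a * s + b * t
    rw [inner_add_left, real_inner_smul_left, real_inner_smul_left]
    gcongr

/-- **Grünbaum's inequality** for open convex sets: a halfspace that contains the centroid in its
interior has at least the fraction `1 / e` of the volume. -/
theorem volume_real_mul_exp_le_of_setIntegral_lt {K : Set (EuclideanSpace ℝ (Fin d))}
    (hKo : IsOpen K) (hKc : Convex ℝ K) (hKb : Bornology.IsBounded K)
    (v : EuclideanSpace ℝ (Fin d)) {t : ℝ}
    (ht : ∫ u in K, inner ℝ u v < t * volume.real K) :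
    volume.real K * Real.exp (-1) ≤ volume.real (K ∩ {u | inner ℝ u v < t}) := by
  have hKfin : volume K ≠ ∞ := hKb.measure_lt_top.ne
  have hint : ∀ {f : EuclideanSpace ℝ (Fin d) → ℝ}, Continuous f → IntegrableOn f K :=
    integrableOn_of_isBounded hKb
  set F : ℝ → ℝ := fun s => volume.real (K ∩ {u | inner ℝ u v < s}) with hFdef
  have hF0 : ∀ s, 0 ≤ F s := fun s => measureReal_nonneg
  have hFm : Monotone F := fun s s' hs => measureReal_mono
    (inter_subset_inter_right _ fun u hu => lt_of_lt_of_le (show inner ℝ u v < s from hu) hs)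
    (hKb.subset inter_subset_left).measure_lt_top.ne
  -- The mean height is below `t`, so some point is too; openness of `K` then gives `F` a positive
  -- value strictly before `t`.
  obtain ⟨u₀, hu₀K, hu₀⟩ : ∃ u ∈ K, inner ℝ u v < t := by
    by_contra! hcon
    have h1 : ∫ u in K, t ≤ ∫ u in K, inner ℝ u v :=
      setIntegral_mono_on (hint continuous_const) (hint (by fun_prop)) hKo.measurableSet hcon
    rw [setIntegral_const, smul_eq_mul, mul_comm] at h1
    linarith
  obtain ⟨s₀, hs₀, hs₀t⟩ := exists_between hu₀
  have hFs₀ : 0 < F s₀ := by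
    refine ENNReal.toReal_pos ?_ (hKb.subset inter_subset_left).measure_lt_top.ne
    exact ((hKo.inter (isOpen_lt (by fun_prop) continuous_const)).measure_pos volume
      ⟨u₀, hu₀K, mem_ofPred_eq ▸ hs₀⟩).ne'
  have hFt : 0 < F t := hFs₀.trans_le (hFm hs₀t.le)
  have hV : 0 < volume.real K := hFt.trans_le (measureReal_mono inter_subset_left hKfin)
  obtain ⟨α, hα⟩ := exists_le_mul_exp_of_logConcave hF0 hFm
    (fun a b ha hb hab s t => volume_real_inner_lt_rpow_mul_le hKo hKc hKb v ha hb hab s t)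
    hs₀t hFs₀
  have hexp : Real.exp (-1) ≤ 1 := Real.exp_le_one_iff.2 (by norm_num)
  rcases le_or_gt α 0 with hα0 | hα0
  -- For `α ≤ 0` the majorant does not grow past `t`, so evaluating it above the top of `K` gives
  -- `vol K ≤ F t`.
  · obtain ⟨C, hC⟩ := hKb.exists_norm_le
    have hb : K ∩ {u | inner ℝ u v < max t (C * ‖v‖ + 1)} = K := by
      refine inter_eq_left.2 fun u hu => ?_
      rw [mem_ofPred_eq]
      refine lt_max_of_lt_right ?_
      have h1 := real_inner_le_norm u v
      have h2 := mul_le_mul_of_nonneg_right (hC u hu) (norm_nonneg v)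
      linarith
    have h1 := hα (max t (C * ‖v‖ + 1))
    simp only [hFdef, hb] at h1
    have h2 : Real.exp (α * (max t (C * ‖v‖ + 1) - t)) ≤ 1 :=
      Real.exp_le_one_iff.2 (mul_nonpos_of_nonpos_of_nonneg hα0 (by simp))
    calc volume.real K * Real.exp (-1) ≤ volume.real K := mul_le_of_le_one_right hV.le hexp
      _ ≤ _ := h1
      _ ≤ F t := mul_le_of_le_one_right hFt.le h2
  -- `τ` is the height at which the exponential majorant reaches `vol K`. The mean of `τ - ⟨u, v⟩`
  -- is then at most `1/α`, whereas the mean height is below `t`; hence `τ - t ≤ 1/α`, i.e. `log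
  -- (vol K / F t) ≤ 1`.
  set τ : ℝ := t + Real.log (volume.real K / F t) / α with hτ
  have hVτ : ∀ s, F (τ - s) ≤ volume.real K * Real.exp (-α * s) := fun s => by
    refine (hα _).trans_eq ?_
    rw [show α * (τ - s - t) = Real.log (volume.real K / F t) + -α * s by
      rw [hτ]; field_simp; ring, Real.exp_add, Real.exp_log (by positivity)]
    field_simp
  have hlayer : ∫ u in K, max (τ - inner ℝ u v) 0 = ∫ s in Ioi (0 : ℝ), F (τ - s) := by
    have hi : IntegrableOn (fun u => max (τ - inner ℝ u v) 0) K := hint (by fun_prop)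
    rw [Integrable.integral_eq_integral_meas_lt hi
      (Filter.Eventually.of_forall fun u => le_max_right _ _)]
    refine setIntegral_congr_fun measurableSet_Ioi fun s hs => ?_
    have hs0 : (0 : ℝ) < s := hs
    have : {u : EuclideanSpace ℝ (Fin d) | s < max (τ - inner ℝ u v) 0} =
        {u | inner ℝ u v < τ - s} := by
      ext u
      simp only [mem_ofPred_eq, lt_max_iff, hs0.not_gt, or_false]
      constructor <;> intro h <;> linarith
    simp only [this, hFdef]
    rw [measureReal_restrict_apply (measurableSet_inner_lt v _), inter_comm]
  have hle : ∫ s in Ioi (0 : ℝ), F (τ - s) ≤ volume.real K * (1 / α) := by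
    have hi : IntegrableOn (fun s => Real.exp (-α * s)) (Ioi 0) :=
      integrableOn_exp_mul_Ioi (by linarith) 0
    calc ∫ s in Ioi (0 : ℝ), F (τ - s)
        ≤ ∫ s in Ioi (0 : ℝ), volume.real K * Real.exp (-α * s) :=
          integral_mono_of_nonneg (Filter.Eventually.of_forall fun s => hF0 _)
            (hi.const_mul _) (Filter.Eventually.of_forall hVτ)
      _ = volume.real K * (1 / α) := by
          rw [integral_const_mul, integral_exp_mul_Ioi (by linarith)]
          simp
  have hge : τ * volume.real K - ∫ u in K, inner ℝ u v ≤ ∫ u in K, max (τ - inner ℝ u v) 0 := by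
    have h1 : ∫ u in K, (τ - inner ℝ u v) = τ * volume.real K - ∫ u in K, inner ℝ u v := by
      rw [integral_sub (hint continuous_const) (hint (by fun_prop)), setIntegral_const,
        smul_eq_mul, mul_comm]
    rw [← h1]
    exact integral_mono (hint (by fun_prop)) (hint (by fun_prop)) fun u => le_max_left _ _
  have h2 : (τ - t) * volume.real K ≤ 1 / α * volume.real K := by linarith
  have h3 : τ - t ≤ 1 / α := le_of_mul_le_mul_right h2 hV
  have h4 : Real.log (volume.real K / F t) ≤ 1 := by
    rw [hτ, add_sub_cancel_left, div_le_div_iff_of_pos_right hα0] at h3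
    exact h3
  rw [Real.log_le_iff_le_exp (by positivity), div_le_iff₀ hFt] at h4
  rw [Real.exp_neg, ← div_eq_mul_inv, div_le_iff₀ (Real.exp_pos _), mul_comm]
  exact h4

/-- The cone need not be closed; the null frontier of a convex set allows passing to the open
interior without a measurability assumption. -/
theorem interior_ae_eq_of_convex {S : Set (EuclideanSpace ℝ (Fin d))} (hS : Convex ℝ S) :
    interior S =ᵐ[volume] S :=
  (interior_subset.eventuallyLE).antisymm <| by
    have h := hS.addHaar_frontier volume
    rw [← closure_sdiff_interior] at h
    exact (subset_closure.eventuallyLE).trans (ae_le_set.2 h)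

theorem inner_centroid {S : Set (EuclideanSpace ℝ (Fin d))} (hSb : Bornology.IsBounded S)
    (v : EuclideanSpace ℝ (Fin d)) :
    inner ℝ (centroid S) v = (volume.real S)⁻¹ * ∫ u in S, inner ℝ u v := by
  rw [centroid, real_inner_smul_left, real_inner_comm,
    ← integral_inner (f := fun u => u) (integrableOn_of_isBounded hSb continuous_id)]
  simp only [real_inner_comm]

/-- **Grünbaum's inequality**: a halfspace that avoids the centroid has at most the fraction
`1 - 1 / e` of the volume. -/
theorem volume_real_inter_le_of_inner_centroid_lt {S : Set (EuclideanSpace ℝ (Fin d))}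
    (hS : Convex ℝ S) (hSb : Bornology.IsBounded S) (v : EuclideanSpace ℝ (Fin d)) {t : ℝ}
    (ht : inner ℝ (centroid S) v < t) :
    volume.real (S ∩ {u | t ≤ inner ℝ u v}) ≤ (1 - Real.exp (-1)) * volume.real S := by
  have hSfin : volume S ≠ ∞ := hSb.measure_lt_top.ne
  have hae := interior_ae_eq_of_convex hS
  rcases (measureReal_nonneg (μ := volume) (s := S)).eq_or_lt with h0 | h0
  · rw [← h0, mul_zero, h0]
    exact measureReal_mono inter_subset_left hSfin
  have h1 : ∫ u in interior S, inner ℝ u v < t * volume.real (interior S) := by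
    rw [setIntegral_congr_set hae, measureReal_congr hae]
    rw [inner_centroid hSb, inv_mul_lt_iff₀ h0, mul_comm] at ht
    exact ht
  have h2 := volume_real_mul_exp_le_of_setIntegral_lt isOpen_interior hS.interior
    (hSb.subset interior_subset) v h1
  have hae2 : (interior S ∩ {u | inner ℝ u v < t} : Set _) =ᵐ[volume]
      (S ∩ {u | inner ℝ u v < t} : Set _) := hae.inter (Filter.EventuallyEq.refl _ _)
  rw [measureReal_congr hae, measureReal_congr hae2] at h2
  have h3 := measureReal_inter_add_sdiff (μ := volume) (s := S) (measurableSet_inner_lt v t) hSfin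
  have h4 : S \ {u | inner ℝ u v < t} = S ∩ {u | t ≤ inner ℝ u v} := by
    ext u
    simp
  rw [h4] at h3
  linarith

/-- A functional strictly separating the centroid from the open interior would have a positive
integral of `f (centroid S) - f u`, yet that integral vanishes. No closedness is needed. -/
theorem centroid_mem {S : Set (EuclideanSpace ℝ (Fin d))} (hS : Convex ℝ S)
    (hSb : Bornology.IsBounded S) (hV : volume.real S ≠ 0) : centroid S ∈ S := by
  by_contra hcon
  have hae := interior_ae_eq_of_convex hS
  obtain ⟨f, hf⟩ := geometric_hahn_banach_open_point hS.interior isOpen_interior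
    (fun h => hcon (interior_subset h))
  have hb : Bornology.IsBounded (interior S) := hSb.subset interior_subset
  have hpos : 0 < volume (interior S) := by
    rw [measure_congr hae]
    exact pos_iff_ne_zero.2 fun h => hV (by simp [Measure.real, h])
  have hint : ∀ {g : EuclideanSpace ℝ (Fin d) → ℝ}, Continuous g → IntegrableOn g (interior S) :=
    integrableOn_of_isBounded hb
  have h1 : 0 < ∫ u in interior S, (f (centroid S) - f u) := by
    rw [setIntegral_pos_iff_support_of_nonneg_ae
      ((ae_restrict_iff' isOpen_interior.measurableSet).2
        (Filter.Eventually.of_forall fun u hu => (sub_pos.2 (hf u hu)).le)) (hint (by fun_prop))]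
    rwa [inter_eq_right.2 fun u hu => Function.mem_support.2 (sub_pos.2 (hf u hu)).ne']
  rw [integral_sub (hint continuous_const) (hint (by fun_prop)), setIntegral_const,
    f.integral_comp_comm (φ := fun u => u) (integrableOn_of_isBounded hb continuous_id), measureReal_congr hae,
    setIntegral_congr_set hae, centroid, map_smul, smul_smul, mul_inv_cancel₀ hV, one_smul,
    sub_self] at h1
  exact h1.false

end Grunbaum

/-! ### Geometry of the search regions. -/

section SearchRegion

variable {d : ℕ}

/-- The search region of the loop after the answers `V`. -/
def searchRegion (W : PointedCone ℝ (EuclideanSpace ℝ (Fin d))) (x : EuclideanSpace ℝ (Fin d))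
    (ε : ℝ) (V : List (EuclideanSpace ℝ (Fin d))) : Set (EuclideanSpace ℝ (Fin d)) :=
  {u | u ∈ W ∧ ‖u‖ ≤ 1 ∧ ∀ v ∈ V, ε ≤ inner ℝ u (v - x)}

variable (W : PointedCone ℝ (EuclideanSpace ℝ (Fin d))) (x : EuclideanSpace ℝ (Fin d)) (ε : ℝ)

theorem searchRegion_nil :
    searchRegion W x ε [] = (W : Set (EuclideanSpace ℝ (Fin d))) ∩ Metric.closedBall 0 1 := by
  ext u
  simp [searchRegion]

theorem searchRegion_append_singleton (V : List (EuclideanSpace ℝ (Fin d)))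
    (v : EuclideanSpace ℝ (Fin d)) :
    searchRegion W x ε (V ++ [v]) = searchRegion W x ε V ∩ {u | ε ≤ inner ℝ u (v - x)} := by
  ext u
  simp only [searchRegion, List.mem_append, List.mem_singleton, mem_ofPred_eq, mem_inter_iff]
  grind

theorem convex_pointedCone : Convex ℝ (W : Set (EuclideanSpace ℝ (Fin d))) :=
  fun _ hu _ hv _ _ ha hb _ =>
    W.add_mem (W.smul_mem ha hu) (W.smul_mem hb hv)

theorem isBounded_searchRegion (V : List (EuclideanSpace ℝ (Fin d))) :
    Bornology.IsBounded (searchRegion W x ε V) :=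
  (Metric.isBounded_closedBall (x := 0) (r := 1)).subset fun u hu => by simpa using hu.2.1

theorem convex_searchRegion (V : List (EuclideanSpace ℝ (Fin d))) :
    Convex ℝ (searchRegion W x ε V) := by
  intro u hu w hw a b ha hb hab
  refine ⟨convex_pointedCone W hu.1 hw.1 ha hb hab, ?_, fun v hv => ?_⟩
  · have := convex_closedBall (0 : EuclideanSpace ℝ (Fin d)) 1
      (by simpa using hu.2.1) (by simpa using hw.2.1) ha hb hab
    simpa using this
  · rw [inner_add_left, real_inner_smul_left, real_inner_smul_left]
    have h1 := mul_le_mul_of_nonneg_left (hu.2.2 v hv) ha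
    have h2 := mul_le_mul_of_nonneg_left (hw.2.2 v hv) hb
    calc ε = a * ε + b * ε := by rw [← add_mul, hab, one_mul]
      _ ≤ _ := add_le_add h1 h2

/-- Even for a null region the query is legal: the default centroid `0` belongs to the cone. -/
theorem centroid_searchRegion_mem (V : List (EuclideanSpace ℝ (Fin d))) :
    centroid (searchRegion W x ε V) ∈ W := by
  by_cases h : volume.real (searchRegion W x ε V) = 0
  · simp [centroid, h]
  · exact (centroid_mem (convex_searchRegion W x ε V) (isBounded_searchRegion W x ε V) h).1

theorem volume_real_searchRegion_nil_pos
    (hW : (interior (W : Set (EuclideanSpace ℝ (Fin d)))).Nonempty) :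
    0 < volume.real (searchRegion W x ε []) := by
  refine ENNReal.toReal_pos ?_ (isBounded_searchRegion W x ε []).measure_lt_top.ne
  obtain ⟨u, hu⟩ := hW
  set c : ℝ := (‖u‖ + 1)⁻¹ with hc
  have hc0 : 0 < c := by positivity
  have hopen : IsOpen (c • interior (W : Set (EuclideanSpace ℝ (Fin d)))) :=
    isOpen_interior.smul₀ hc0.ne'
  have hne : (c • interior (W : Set (EuclideanSpace ℝ (Fin d))) ∩ Metric.ball 0 1).Nonempty := by
    refine ⟨c • u, smul_mem_smul_set hu, ?_⟩
    rw [mem_ball_zero_iff, norm_smul, Real.norm_of_nonneg hc0.le, hc,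
      inv_mul_lt_iff₀ (by positivity)]
    linarith
  refine (((hopen.inter Metric.isOpen_ball).measure_pos volume hne).trans_le
    (measure_mono ?_)).ne'
  rintro _ ⟨⟨w, hw, rfl⟩, hb⟩
  exact ⟨W.smul_mem hc0.le (interior_subset hw),
    (mem_ball_zero_iff.1 hb).le, by simp⟩

theorem volume_real_image_add_smul (p : EuclideanSpace ℝ (Fin d)) {t : ℝ} (ht : 0 ≤ t)
    (S : Set (EuclideanSpace ℝ (Fin d))) :
    volume.real ((fun u => p + t • u) '' S) = t ^ d * volume.real S := by
  have : (fun u => p + t • u) '' S = p +ᵥ t • S := by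
    ext y
    simp [mem_vadd_set, mem_smul_set]
  rw [this, Measure.real, measure_vadd, Measure.addHaar_smul]
  simp [abs_of_nonneg ht, ENNReal.toReal_mul, Measure.real, ht]

/-- If some unit vector of the cone has a margin `3 ε` for all the answers, then the search region
contains a copy of the initial one scaled by `ε / (4 R)`. -/
theorem le_volume_real_searchRegion {R : ℝ} {V : List (EuclideanSpace ℝ (Fin d))}
    {w : EuclideanSpace ℝ (Fin d)} {ε : ℝ} (hε : 0 < ε) (hεR : ε ≤ 2 * R) (hx : ‖x‖ ≤ R)
    (hV : ∀ v ∈ V, ‖v‖ ≤ R) (hwW : w ∈ W) (hw : ‖w‖ = 1)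
    (hwV : ∀ v ∈ V, 3 * ε ≤ inner ℝ w (v - x)) :
    (ε / (4 * R)) ^ d * volume.real (searchRegion W x ε []) ≤
      volume.real (searchRegion W x ε V) := by
  have hR : 0 < R := by linarith
  set t : ℝ := ε / (4 * R) with ht
  have ht0 : 0 ≤ t := by positivity
  have ht4 : t * (4 * R) = ε := by rw [ht]; field_simp
  have ht1 : t ≤ 1 := by rw [ht, div_le_one (by positivity)]; linarith
  rw [← volume_real_image_add_smul ((1 - t) • w) ht0]
  refine measureReal_mono ?_ (isBounded_searchRegion W x ε V).measure_lt_top.ne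
  rintro _ ⟨u, hu, rfl⟩
  refine ⟨convex_pointedCone W hwW hu.1 (by linarith) ht0 (by ring), ?_, fun v hv => ?_⟩
  · calc ‖(1 - t) • w + t • u‖ ≤ (1 - t) * ‖w‖ + t * ‖u‖ := by
          refine (norm_add_le _ _).trans_eq ?_
          rw [norm_smul, norm_smul, Real.norm_of_nonneg ht0, Real.norm_of_nonneg (by linarith)]
      _ ≤ (1 - t) * 1 + t * 1 := by
          have := mul_le_mul_of_nonneg_left hu.2.1 ht0
          rw [hw]
          linarith
      _ = 1 := by ring
  · show ε ≤ inner ℝ ((1 - t) • w + t • u) (v - x)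
    rw [inner_add_left, real_inner_smul_left, real_inner_smul_left]
    have h1 : -(2 * R) ≤ inner ℝ u (v - x) := by
      have h2 := abs_le.1 (abs_real_inner_le_norm u (v - x))
      have h3 : ‖v - x‖ ≤ 2 * R := (norm_sub_le _ _).trans (by linarith [hV v hv])
      have h4 : ‖u‖ * ‖v - x‖ ≤ 1 * (2 * R) :=
        mul_le_mul hu.2.1 h3 (norm_nonneg _) zero_le_one
      linarith [h2.1]
    -- The margin is at least `(1 - t) * 3ε - t * 2R`. Here `t * 2R = ε/2`, and `t ≤ 1/2` gives `3tε
    -- ≤ 3ε/2`, so exactly `ε` remains.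
    have h5 := mul_le_mul_of_nonneg_left h1 ht0
    have h6 := mul_le_mul_of_nonneg_left (hwV v hv) (sub_nonneg.2 ht1)
    have h7 := mul_le_mul_of_nonneg_left hεR ht0
    linarith

end SearchRegion

/-! ### Projection onto the simplex hull plus the dual cone. -/

section Decomposition

variable {d n : ℕ} (W : PointedCone ℝ (EuclideanSpace ℝ (Fin d)))

/-- The points `∑ i, p i • V i + c` with `p` in the simplex and `c` in the dual cone. -/
def simplexAddDual (V : Fin n → EuclideanSpace ℝ (Fin d)) : Set (EuclideanSpace ℝ (Fin d)) :=
  Fintype.linearCombination ℝ V '' stdSimplex ℝ (Fin n) +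
    (ProperCone.innerDual (W : Set (EuclideanSpace ℝ (Fin d))) : Set (EuclideanSpace ℝ (Fin d)))

theorem add_mem_simplexAddDual (V : Fin n → EuclideanSpace ℝ (Fin d)) {p : Fin n → ℝ}
    (hp : p ∈ stdSimplex ℝ (Fin n)) {c : EuclideanSpace ℝ (Fin d)}
    (hc : c ∈ ProperCone.innerDual (W : Set (EuclideanSpace ℝ (Fin d)))) :
    (∑ i, p i • V i) + c ∈ simplexAddDual W V :=
  add_mem_add ⟨p, hp, by simp [Fintype.linearCombination_apply]⟩ hc

theorem isClosed_simplexAddDual (V : Fin n → EuclideanSpace ℝ (Fin d)) :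
    IsClosed (simplexAddDual W V) :=
  (ProperCone.innerDual (W : Set (EuclideanSpace ℝ (Fin d)))).isClosed.add_left_of_isCompact
    ((isCompact_stdSimplex ℝ (Fin n)).image (LinearMap.continuous_of_finiteDimensional _))

theorem convex_simplexAddDual (V : Fin n → EuclideanSpace ℝ (Fin d)) :
    Convex ℝ (simplexAddDual W V) :=
  ((convex_stdSimplex ℝ (Fin n)).linear_image _).add
    (convex_pointedCone (ProperCone.innerDual (W : Set (EuclideanSpace ℝ (Fin d)))).toPointedCone)

/-- The minimum is attained because a compact set plus a closed cone is closed. -/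
theorem exists_isOptimalWeights (hn : 0 < n) (x : EuclideanSpace ℝ (Fin d))
    (V : Fin n → EuclideanSpace ℝ (Fin d)) : ∃ p, IsOptimalWeights W x V p := by
  have hne : (simplexAddDual W V).Nonempty :=
    ⟨_, add_mem_simplexAddDual W V (single_mem_stdSimplex ℝ (⟨0, hn⟩ : Fin n)) (zero_mem _)⟩
  obtain ⟨_, ⟨_, ⟨p, hp, rfl⟩, c, hc, rfl⟩, hmin⟩ :=
    (isClosed_simplexAddDual W V).exists_infDist_eq_dist hne x
  refine ⟨p, hp, c, hc, fun p' hp' c' hc' => ?_⟩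
  have h := Metric.infDist_le_dist_of_mem (x := x) (add_mem_simplexAddDual W V hp' hc')
  rw [hmin, dist_comm, dist_comm x, dist_eq_norm, dist_eq_norm] at h
  simpa [Fintype.linearCombination_apply] using h

theorem mem_closure_of_forall_innerDual {z : EuclideanSpace ℝ (Fin d)}
    (hz : ∀ c ∈ ProperCone.innerDual (W : Set (EuclideanSpace ℝ (Fin d))), 0 ≤ inner ℝ c z) :
    z ∈ closure (W : Set (EuclideanSpace ℝ (Fin d))) := by
  set C : ProperCone ℝ (EuclideanSpace ℝ (Fin d)) := Submodule.closure W
  have h1 : z ∈ ProperCone.innerDual (ProperCone.innerDual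
      (C : Set (EuclideanSpace ℝ (Fin d))) : Set (EuclideanSpace ℝ (Fin d))) := fun c hc =>
    hz c fun u hu => hc (subset_closure hu)
  rw [ProperCone.innerDual_innerDual] at h1
  exact h1

/-- If the best approximation of `x` is farther than `δ`, some unit vector of the cone separates
`x` from all the points `V i` with margin `δ`. -/
theorem exists_unit_mem_cone_of_lt_norm (hn : 0 < n) {x : EuclideanSpace ℝ (Fin d)}
    {V : Fin n → EuclideanSpace ℝ (Fin d)} {p : Fin n → ℝ} {c : EuclideanSpace ℝ (Fin d)}
    (hp : p ∈ stdSimplex ℝ (Fin n))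
    (hc : c ∈ ProperCone.innerDual (W : Set (EuclideanSpace ℝ (Fin d))))
    (hmin : ∀ p' ∈ stdSimplex ℝ (Fin n),
      ∀ c' ∈ ProperCone.innerDual (W : Set (EuclideanSpace ℝ (Fin d))),
        ‖(∑ i, p i • V i) + c - x‖ ≤ ‖(∑ i, p' i • V i) + c' - x‖)
    {δ : ℝ} (hδ : 0 < δ) (hlt : δ < ‖(∑ i, p i • V i) + c - x‖) :
    ∃ w ∈ W, ‖w‖ = 1 ∧ ∀ i, δ ≤ inner ℝ w (V i - x) := by
  set y := (∑ i, p i • V i) + c with hy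
  set z := y - x with hz
  have hz0 : 0 < ‖z‖ := hδ.trans hlt
  have hyC : y ∈ simplexAddDual W V := add_mem_simplexAddDual W V hp hc
  have hinf : ‖x - y‖ = ⨅ w : simplexAddDual W V, ‖x - w‖ := by
    have : Nonempty (simplexAddDual W V) := ⟨⟨y, hyC⟩⟩
    refine le_antisymm (le_ciInf ?_)
      (ciInf_le ⟨0, by rintro _ ⟨w, rfl⟩; positivity⟩ (⟨y, hyC⟩ : simplexAddDual W V))
    rintro ⟨_, _, ⟨p', hp', rfl⟩, c', hc', rfl⟩
    rw [norm_sub_rev, norm_sub_rev x]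
    simpa [Fintype.linearCombination_apply] using hmin p' hp' c' hc'
  have hproj := (norm_eq_iInf_iff_real_inner_le_zero (convex_simplexAddDual W V) hyC).1 hinf
  -- The obtuse-angle characterization of the projection `y`: the residual `z` has inner product at
  -- least `‖z‖ ^ 2` with every `q - x`.
  have hge : ∀ q ∈ simplexAddDual W V, ‖z‖ ^ 2 ≤ inner ℝ z (q - x) := by
    intro q hq
    have h1 := hproj q hq
    rw [← neg_sub y x, inner_neg_left, ← hz] at h1
    have h2 : q - x = z + (q - y) := by rw [hz]; abel
    rw [h2, inner_add_right, real_inner_self_eq_norm_sq]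
    linarith
  have hVc : ∀ i, ∀ c' ∈ ProperCone.innerDual (W : Set (EuclideanSpace ℝ (Fin d))),
      V i + c' ∈ simplexAddDual W V := fun i c' hc' => by
    have := add_mem_simplexAddDual W V (single_mem_stdSimplex ℝ i) hc'
    simpa [Pi.single_apply, ite_smul] using this
  have hzV : ∀ i, ‖z‖ ^ 2 ≤ inner ℝ z (V i - x) := fun i => by
    simpa using hge _ (hVc i 0 (zero_mem _))
  -- If `⟨c', z⟩ < 0`, moving far along `c'` would violate the lower bound `hge`. So `z` lies in the
  -- bidual of `W`, which is its closure.
  have hzcl : z ∈ closure (W : Set (EuclideanSpace ℝ (Fin d))) := by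
    refine mem_closure_of_forall_innerDual W fun c' hc' => ?_
    by_contra! hneg
    set i : Fin n := ⟨0, hn⟩
    obtain ⟨N, hN⟩ := exists_nat_gt (inner ℝ z (V i - x) / -inner ℝ c' z)
    rw [div_lt_iff₀ (by linarith)] at hN
    have h1 := hge _ (hVc i ((N : ℝ) • c') ?_)
    · rw [add_sub_right_comm, inner_add_right, real_inner_smul_right, real_inner_comm c' z] at h1
      have := sq_nonneg ‖z‖
      linarith
    · intro u hu
      have := hc' hu
      simp only [innerₗ_apply_apply] at this ⊢
      rw [real_inner_smul_right]
      positivity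
  -- `z` itself may lie outside `W`. The strict inequality `δ < ‖z‖` makes the margin condition
  -- open, so a nearby vector of `W` satisfies it.
  have hopen : IsOpen ({u : EuclideanSpace ℝ (Fin d) | u ≠ 0} ∩
      ⋂ i, {u | δ * ‖u‖ < inner ℝ u (V i - x)}) :=
    isOpen_ne.inter (isOpen_iInter_of_finite fun i => isOpen_lt (by fun_prop) (by fun_prop))
  obtain ⟨u, ⟨hu0, huV⟩, huW⟩ := mem_closure_iff.1 hzcl _ hopen
    ⟨norm_pos_iff.1 hz0, mem_iInter.2 fun i =>
      (mul_lt_mul_of_pos_right hlt hz0).trans_le ((sq ‖z‖).symm.trans_le (hzV i))⟩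
  have hu0' : 0 < ‖u‖ := norm_pos_iff.2 hu0
  refine ⟨‖u‖⁻¹ • u, W.smul_mem (by positivity) huW, ?_, fun i => ?_⟩
  · rw [norm_smul, norm_inv, norm_norm, inv_mul_cancel₀ hu0'.ne']
  · rw [real_inner_smul_left, le_inv_mul_iff₀ hu0', mul_comm]
    exact (mem_iInter.1 huV i).le

end Decomposition

/-! ### The iteration count. -/

/-- The constant 5 comes from `1 - 1/e < 4/5 ≤ exp (-1/5)`: five rounds shrink the volume by at
least a factor `e`. Strictness needs a nonzero exponent, which `4R/ε ≥ 2` and `d ≥ 1` provide. -/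
theorem pow_natCeil_lt {d : ℕ} (hd : 1 ≤ d) {R ε : ℝ} (hε : 0 < ε) (hεR : ε ≤ 2 * R) :
    (1 - Real.exp (-1)) ^ sodBound d R ε < (ε / (4 * R)) ^ d := by
  have hR : 0 < R := by linarith
  have hlog : 0 < Real.log (4 * R / ε) :=
    Real.log_pos ((one_lt_div hε).2 (by linarith))
  have hd' : (0 : ℝ) < d := by exact_mod_cast hd
  have hk : 5 * (d : ℝ) * Real.log (4 * R / ε) ≤ sodBound d R ε := Nat.le_ceil _
  have hk0 : sodBound d R ε ≠ 0 := by
    intro h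
    rw [h, Nat.cast_zero] at hk
    have : 0 < 5 * (d : ℝ) * Real.log (4 * R / ε) := by positivity
    linarith
  have hθ : 1 - Real.exp (-1) < Real.exp (-(1 / 5)) := by
    have h1 : Real.exp 1 < 5 := Real.exp_one_lt_d9.trans (by norm_num)
    have h2 : (1 / 5 : ℝ) < Real.exp (-1) := by
      rw [Real.exp_neg, one_div]
      exact inv_strictAnti₀ (Real.exp_pos 1) h1
    have h3 := Real.add_one_le_exp (-(1 / 5) : ℝ)
    linarith
  have hθ0 : 0 ≤ 1 - Real.exp (-1) := sub_nonneg.2 (Real.exp_le_one_iff.2 (by norm_num))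
  calc (1 - Real.exp (-1)) ^ sodBound d R ε < Real.exp (-(1 / 5)) ^ sodBound d R ε :=
        pow_lt_pow_left₀ hθ hθ0 hk0
    _ = Real.exp (-(sodBound d R ε / 5)) := by
        rw [← Real.exp_nat_mul]
        ring_nf
    _ ≤ Real.exp (d * -Real.log (4 * R / ε)) := by
        refine Real.exp_le_exp.2 ?_
        linarith
    _ = (ε / (4 * R)) ^ d := by
        rw [Real.exp_nat_mul, ← Real.log_inv, Real.exp_log (by positivity), inv_div]

/-! ### Correctness of the loop. -/

section Loop

variable {d : ℕ} {W : PointedCone ℝ (EuclideanSpace ℝ (Fin d))} {x : EuclideanSpace ℝ (Fin d)}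

theorem length_queries_sodLoop_le (ε : ℝ) (O : EuclideanSpace ℝ (Fin d) → EuclideanSpace ℝ (Fin d))
    (m : ℕ) (S : Set (EuclideanSpace ℝ (Fin d))) (V : List (EuclideanSpace ℝ (Fin d))) :
    ((sodLoop x ε W m S V).queries O).length ≤ m := by
  induction m generalizing S V with
  | zero => simp [sodLoop, OracleProg.queries]
  | succ m ih =>
    rw [sodLoop, OracleProg.queries, List.length_cons]
    split_ifs
    · simp [OracleProg.queries]
    · exact Nat.succ_le_succ (ih _ _)

theorem mem_of_mem_queries_sodLoop (ε : ℝ)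
    (O : EuclideanSpace ℝ (Fin d) → EuclideanSpace ℝ (Fin d)) (m : ℕ)
    (V : List (EuclideanSpace ℝ (Fin d))) :
    ∀ q ∈ (sodLoop x ε W m (searchRegion W x ε V) V).queries O, q ∈ W := by
  induction m generalizing V with
  | zero => simp [sodLoop, OracleProg.queries]
  | succ m ih =>
    intro q hq
    rw [sodLoop, OracleProg.queries, List.mem_cons] at hq
    rcases hq with rfl | hq
    · exact centroid_searchRegion_mem W x ε V
    · split_ifs at hq
      · simp [OracleProg.queries] at hq
      · rw [← searchRegion_append_singleton] at hq
        exact ih _ q hq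

/-- If the search region has become too small, every optimal decomposition is within `3 ε`. -/
theorem isCorrect_decomposition {K Kstar : Set (EuclideanSpace ℝ (Fin d))} {R ε : ℝ}
    (hKR : K ⊆ Metric.closedBall 0 R) (hx : x ∈ Metric.closedBall 0 R) (hε : 0 < ε)
    (hεR : ε ≤ 2 * R) {V : List (EuclideanSpace ℝ (Fin d))} (hV0 : 0 < V.length)
    (hV : ∀ v ∈ V, v ∈ K)
    (hvol : volume.real (searchRegion W x ε V) <
      (ε / (4 * R)) ^ d * volume.real (searchRegion W x ε []))
    {p : Fin V.length → ℝ} (hp : IsOptimalWeights W x V.get p) :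
    (SODOutput.decomposition V.length V.get p).IsCorrect K Kstar W x ε V.length := by
  obtain ⟨hp, c, hc, hmin⟩ := hp
  refine ⟨rfl, fun i => hV _ (V.get_mem i), hp, c, hc, ?_⟩
  rw [sub_add_eq_add_sub]
  by_contra! hlt
  obtain ⟨w, hwW, hw, hwV⟩ :=
    exists_unit_mem_cone_of_lt_norm W hV0 hp hc hmin (by positivity) hlt
  refine hvol.not_ge (le_volume_real_searchRegion W x hε hεR (by simpa using hx)
    (fun v hv => by simpa using hKR (hV v hv)) hwW hw fun v hv => ?_)
  obtain ⟨i, rfl⟩ := List.get_of_mem hv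
  exact hwV i

theorem isCorrect_hyperplane {K Kstar : Set (EuclideanSpace ℝ (Fin d))}
    {O : EuclideanSpace ℝ (Fin d) → EuclideanSpace ℝ (Fin d)} (hO : IsImproperOracle K Kstar W O)
    {ε : ℝ} (hε : 0 < ε) {w : EuclideanSpace ℝ (Fin d)} (hw : w ∈ W)
    (h : inner ℝ w x ≤ inner ℝ w (O w) - ε) (hw1 : ‖w‖ ≤ 1) (k : ℕ) :
    (SODOutput.hyperplane (‖w‖⁻¹ • w) (inner ℝ w (O w) / ‖w‖)).IsCorrect K Kstar W x ε k := by
  -- A zero query cannot pass the stopping test, which would read `0 ≤ -ε`.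
  have hw0 : 0 < ‖w‖ := by
    refine norm_pos_iff.2 fun h0 => ?_
    simp only [h0, inner_zero_left] at h
    linarith
  refine ⟨by rw [norm_smul, norm_inv, norm_norm, inv_mul_cancel₀ hw0.ne'], ?_, fun y hy => ?_⟩
  -- Since `‖w‖ ≤ 1`, normalizing can only enlarge the margin.
  · have h1 : ε ≤ ε / ‖w‖ := (le_div_iff₀ hw0).2 (mul_le_of_le_one_right hε.le hw1)
    rw [real_inner_smul_left, inv_mul_eq_div]
    have h2 := div_le_div_of_nonneg_right h hw0.le
    rw [sub_div] at h2
    linarith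
  · rw [real_inner_smul_left, inv_mul_eq_div]
    have := div_le_div_of_nonneg_right (hO.le w hw y hy) hw0.le
    linarith

theorem norm_centroid_searchRegion_le (ε : ℝ) (V : List (EuclideanSpace ℝ (Fin d))) :
    ‖centroid (searchRegion W x ε V)‖ ≤ 1 := by
  by_cases h : volume.real (searchRegion W x ε V) = 0
  · simp [centroid, h]
  · exact (centroid_mem (convex_searchRegion W x ε V) (isBounded_searchRegion W x ε V) h).2.1

/-- Induction on the remaining rounds; the invariant `hvol` records one factor `1 - 1/e` per answer.
-/
theorem result_sodLoop {K Kstar : Set (EuclideanSpace ℝ (Fin d))}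
    {O : EuclideanSpace ℝ (Fin d) → EuclideanSpace ℝ (Fin d)} (hO : IsImproperOracle K Kstar W O)
    {R ε : ℝ} (hd : 1 ≤ d) (hW : (interior (W : Set (EuclideanSpace ℝ (Fin d)))).Nonempty)
    (hKR : K ⊆ Metric.closedBall 0 R) (hx : x ∈ Metric.closedBall 0 R) (hε : 0 < ε)
    (hεR : ε ≤ 2 * R) (m : ℕ) (V : List (EuclideanSpace ℝ (Fin d)))
    (hm : V.length + m = sodBound d R ε) (hV : ∀ v ∈ V, v ∈ K)
    (hvol : volume.real (searchRegion W x ε V) ≤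
      (1 - Real.exp (-1)) ^ V.length * volume.real (searchRegion W x ε [])) :
    ((sodLoop x ε W m (searchRegion W x ε V) V).result O).Nonempty ∧
      ∀ out ∈ (sodLoop x ε W m (searchRegion W x ε V) V).result O,
        out.IsCorrect K Kstar W x ε (sodBound d R ε) := by
  induction m generalizing V with
  | zero =>
    rw [add_zero] at hm
    have hlt := pow_natCeil_lt hd hε hεR
    rw [← hm] at hlt ⊢
    -- With no answers the simplex would be empty and no minimizer would exist.
    have hV0 : 0 < V.length := by
      refine Nat.pos_of_ne_zero fun h0 => ?_
      rw [h0, pow_zero] at hlt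
      refine hlt.not_ge (pow_le_one₀ (div_nonneg hε.le (by linarith)) ?_)
      rw [div_le_one (by linarith)]
      linarith
    rw [sodLoop, OracleProg.result]
    refine ⟨?_, ?_⟩
    · obtain ⟨p, hp⟩ := exists_isOptimalWeights W hV0 x V.get
      exact ⟨_, p, hp, rfl⟩
    · rintro _ ⟨p, hp, rfl⟩
      exact isCorrect_decomposition hKR hx hε hεR hV0 hV
        (hvol.trans_lt (mul_lt_mul_of_pos_right hlt (volume_real_searchRegion_nil_pos W x ε hW))) hp
  | succ m ih =>
    have hcW := centroid_searchRegion_mem W x ε V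
    rw [sodLoop, OracleProg.result]
    split_ifs with h
    · rw [OracleProg.result]
      refine ⟨singleton_nonempty _, ?_⟩
      rintro _ rfl
      exact isCorrect_hyperplane hO hε hcW h (norm_centroid_searchRegion_le ε V) _
    · rw [← searchRegion_append_singleton]
      refine ih _ (by rw [List.length_append, List.length_singleton]; omega) ?_ ?_
      · simp only [List.mem_append, List.mem_singleton]
        rintro v (hv | rfl)
        · exact hV v hv
        · exact hO.mem _ hcW
      · have hθ0 : 0 ≤ 1 - Real.exp (-1) :=
          sub_nonneg.2 (Real.exp_le_one_iff.2 (by norm_num))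
        rw [searchRegion_append_singleton, List.length_append, List.length_singleton, pow_succ',
          mul_assoc]
        refine (volume_real_inter_le_of_inner_centroid_lt (convex_searchRegion W x ε V)
          (isBounded_searchRegion W x ε V) _ ?_).trans (mul_le_mul_of_nonneg_left hvol hθ0)
        -- Failure of the stopping test says that the centroid violates the new constraint, as
        -- Grünbaum's inequality requires.
        rw [inner_sub_right]
        linarith

end Loop

end

theorem mainTheorem5 {d : ℕ} (hd : 1 ≤ d) {R : ℝ}
    {K Kstar : Set (EuclideanSpace ℝ (Fin d))}
    (hK : IsCompact K) (hKstar : IsCompact Kstar)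
    (hKR : K ⊆ Metric.closedBall 0 R) (hKstarR : Kstar ⊆ Metric.closedBall 0 R)
    (W : PointedCone ℝ (EuclideanSpace ℝ (Fin d)))
    (hW : (interior (W : Set (EuclideanSpace ℝ (Fin d)))).Nonempty)
    (O : EuclideanSpace ℝ (Fin d) → EuclideanSpace ℝ (Fin d))
    (hO : IsImproperOracle K Kstar W O)
    (x : EuclideanSpace ℝ (Fin d)) (hx : x ∈ Metric.closedBall 0 R)
    (ε : ℝ) (hε : 0 < ε) (hεR : ε ≤ 2 * R) :
    ((sod R x ε W).queries O).length ≤ ⌈5 * (d : ℝ) * Real.log (4 * R / ε)⌉₊ ∧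
    (∀ q ∈ (sod R x ε W).queries O, q ∈ W) ∧
    ((sod R x ε W).result O).Nonempty ∧
    ∀ out ∈ (sod R x ε W).result O,
      out.IsCorrect K Kstar W x ε ⌈5 * (d : ℝ) * Real.log (4 * R / ε)⌉₊ := by
  rw [sod, ← searchRegion_nil W x ε]
  have h := result_sodLoop hO hd hW hKR hx hε hεR (sodBound d R ε) [] (by simp) (by simp) (by simp)
  exact ⟨length_queries_sodLoop_le ε O _ _ _, mem_of_mem_queries_sodLoop ε O _ _, h.1, h.2⟩
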